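/- **Definitions.** Let $A$ be a set of $m$ buyers and $B$ an infinite set of houses; every buyer has a preference list, i.e. a well-ordering of $B$ (so that there is a favourite house in every nonempty set of houses). A matching is an injective map $\tau:A\to B$, and $s(\tau)=\{\tau(a):a\in A\}$ is its set of sold houses. A matching $\tau$ is Pareto optimal if there are no nonempty $A'\subseteq A$ and matching $\tau'$ that differs from $\tau$ only on $A'$ such that every $a\in A'$ places $\tau'(a)$ strictly higher than $\tau(a)$ in its preference list. A set $E\subseteq B$ is reachable if $E=s(\tau)$ for some Pareto optimal matching $\tau$. Let $f(m)$ be the largest number of reachable sets, taken over all infinite sets $B$ and all $m$-tuples of preference lists. A family $\mathcal F$ of $m$-element sets has property $P$ if for every integer $k\ge 1$ and all $F_1,\dots,F_k\in\mathcal F$ there is $j\in\{1,\dots,k\}$ with $|F_j\setminus\bigcup_{i\ne j}F_i|\le\lfloor m/k\rfloor$. Let $g(m)$ be the largest cardinality of a family of $m$-element sets with property $P$. **Theorem.** (i) Let $\ell=\ell(m)$ be the largest integer with $\ell^\ell\le m$. If $m$ is sufficiently large, then $f(m)\le\binom{2m-\ell+4}{m}$; that is, for any preference lists of $m$ buyers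 there are at most $\binom{2m-\ell+4}{m}$ reachable sets. (ii) For every $m\ge 1$, every family $\mathcal F$ of $m$-element sets with property $P$ satisfies $|\mathcal F|\le\binom{2m-1}{m}$; hence $g(m)\le\binom{2m-1}{m}$. (For $m=0$ this holds as well, with the bound read as $1$.) -/

import Mathlib

universe u

/-- A matching of the buyers `A` into the houses `B` is an embedding `A ↪ B`, and `pref a x y` says
that buyer `a` places house `x` strictly before (higher than) house `y`.
`A'` is a blocking coalition for `τ` if it is nonempty and some matching `τ'` that differs from `τ`
only on `A'` gives every member of `A'` a house that this member places higher. -/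
def IsBlockingCoalition {A B : Type*} (pref : A → B → B → Prop) (τ : A ↪ B) (A' : Set A) : Prop :=
  A'.Nonempty ∧ ∃ τ' : A ↪ B, (∀ a, a ∉ A' → τ' a = τ a) ∧ ∀ a ∈ A', pref a (τ' a) (τ a)

/-- Pareto optimal matchings. -/
def IsPOM {A B : Type*} (pref : A → B → B → Prop) (τ : A ↪ B) : Prop :=
  ¬ ∃ A' : Set A, IsBlockingCoalition pref τ A'

/-- The set of houses that are sold in a matching. -/
def soldHouses {A B : Type*} [Fintype A] (τ : A ↪ B) : Finset B :=
  Finset.univ.map τ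

/-- The family of reachable sets of houses. -/
def reachableSets {A B : Type*} [Fintype A] (pref : A → B → B → Prop) : Set (Finset B) :=
  {E | ∃ τ : A ↪ B, IsPOM pref τ ∧ soldHouses τ = E}

/-- `f(m)`: the largest number of reachable sets, over all infinite sets `B` of houses and all
`m`-tuples of preference lists. A preference list is a well-ordering of `B`: there is a favourite
house in every nonempty set of houses. -/
noncomputable def maxReachable (m : ℕ) : ℕ∞ :=
  ⨆ (B : Type u) (_ : Infinite B) (pref : Fin m → B → B → Prop)
    (_ : ∀ a, IsWellOrder B (pref a)), (reachableSets pref).encard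

/-- `F` is a family of `m`-element sets with property `P`. -/
def HasPropertyP {α : Type*} (m : ℕ) (F : Set (Finset α)) : Prop :=
  (∀ S ∈ F, S.card = m) ∧
    ∀ k : ℕ, 1 ≤ k → ∀ G : Fin k → Finset α, (∀ i, G i ∈ F) →
      ∃ j, ((G j : Set α) \ ⋃ i, ⋃ (_ : i ≠ j), (G i : Set α)).ncard ≤ m / k

/-- `g(m)`: the largest cardinality of a family of `m`-element sets with property `P`. -/
noncomputable def maxPropertyP (m : ℕ) : ℕ∞ :=
  ⨆ (α : Type u) (F : Set (Finset α)) (_ : HasPropertyP m F), F.encard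

/-! Both bounds rest on the skew Bollobás inequality (`card_le_choose_of_skew_set_pairs`), applied
to members `E` of a family and small sets disjoint from `E` that meet all other members. For
reachable sets the buyers' favourite houses outside `E` form such a set. This gives `(2m).choose m`,
and `(2m - t).choose m` for the reachable sets containing `t` fixed houses. So it pays to find
common houses: either many houses lie in every reachable set, or the favourites outside the few
common ones are so spread out that every reachable set contains almost all of a fixed large set of
houses (`encard_reachableSets_le`). For property `P`, a minimal blocking set has at most `m` points
(case `k = m + 1`), and members intersect pairwise (case `k = 2`), so each pair can be used in both
orders. This halves `(2m).choose m`. -/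

/-! ### Set-pair inequalities by the polynomial method -/

/-- If the matrix of values of degree `b` forms in `a + 1` variables at some points is triangular
with nonzero diagonal, then there are at most `(a + b).choose a` of them. -/
theorem card_le_choose_of_triangular_eval {ι : Type*} [Fintype ι] [LinearOrder ι] {a b : ℕ}
    (c : ι → Fin (a + 1) → ℚ) (φ : ι → MvPolynomial (Fin (a + 1)) ℚ)
    (hφ : ∀ i, (φ i).IsHomogeneous b)
    (hdiag : ∀ i, MvPolynomial.eval (c i) (φ i) ≠ 0)
    (htri : ∀ i j, i < j → MvPolynomial.eval (c i) (φ j) = 0) :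
    Fintype.card ι ≤ (a + b).choose a := by
  classical
  set s := Finset.finsuppAntidiag (Finset.univ : Finset (Fin (a + 1))) b with hs
  let V : Matrix ι s ℚ := Matrix.of fun i d => ∏ k, c i k ^ (d : Fin (a + 1) →₀ ℕ) k
  let W : Matrix s ι ℚ := Matrix.of fun d j => (φ j).coeff d
  have hVW : ∀ i j, (V * W) i j = MvPolynomial.eval (c i) (φ j) := by
    intro i j
    have hsub : (φ j).support ⊆ s := by
      intro d hd
      have h := hφ j (MvPolynomial.mem_support_iff.mp hd)
      simp only [hs, Finset.mem_finsuppAntidiag, Finset.subset_univ, and_true]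
      rw [← h, Finsupp.weight_apply, Finsupp.sum_fintype _ _ (by simp)]
      simp
    rw [MvPolynomial.eval_eq', Finset.sum_subset hsub, Matrix.mul_apply, ← Finset.sum_coe_sort s]
    · exact Finset.sum_congr rfl fun d _ => mul_comm _ _
    · intro d _ hd
      rw [MvPolynomial.notMem_support_iff.mp hd, zero_mul]
  have hdet : (V * W).det = ∏ i, (V * W) i i := by
    apply Matrix.det_of_isLowerTriangular
    intro i j hij
    rw [hVW]
    exact htri i j hij
  have hunit : IsUnit (V * W) := by
    rw [Matrix.isUnit_iff_isUnit_det, hdet, isUnit_iff_ne_zero, Finset.prod_ne_zero_iff]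
    intro i _
    rw [hVW]
    exact hdiag i
  calc Fintype.card ι = (V * W).rank := (Matrix.rank_of_isUnit _ hunit).symm
    _ ≤ V.rank := Matrix.rank_mul_le_left _ _
    _ ≤ Fintype.card s := Matrix.rank_le_card_width _
    _ = (a + b).choose a := by
      rw [Fintype.card_coe, hs, Finset.card_finsuppAntidiag_nat_eq_choose, Finset.card_univ,
        Fintype.card_fin, show a + 1 + b - 1 = a + b by omega, Nat.choose_symm_add]

open Polynomial in
/-- The skew version of Bollobás's theorem on set pairs. -/
theorem card_le_choose_of_skew_set_pairs {ι α : Type*} [Fintype ι] [LinearOrder ι] {a b : ℕ}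
    (A B : ι → Finset α) (hA : ∀ i, (A i).card ≤ a) (hB : ∀ i, (B i).card ≤ b)
    (hdisj : ∀ i, Disjoint (A i) (B i)) (hmeet : ∀ i j, i < j → ¬ Disjoint (A i) (B j)) :
    Fintype.card ι ≤ (a + b).choose a := by
  classical
  obtain ⟨f, hf⟩ := Set.countable_iff_exists_injOn.mp
    (Finset.univ.biUnion fun i => A i ∪ B i).countable_toSet
  have hfinj : ∀ i j, ∀ x ∈ A i, ∀ y ∈ B j, f x = f y → x = y := by
    intro i j x hx y hy hxy
    refine hf ?_ ?_ hxy
    · simpa using ⟨i, Or.inl hx⟩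
    · simpa using ⟨j, Or.inr hy⟩
  -- The shift keeps all points away from 0, the root added by the padding factor in `P`.
  let t : α → ℚ := fun x => (f x : ℚ) + 1
  have ht0 : ∀ x, t x ≠ 0 := fun x => by positivity
  have ht : ∀ x y, t x = t y ↔ f x = f y := fun x y => by simp [t]
  let P : ι → ℚ[X] := fun i => X ^ (a - (A i).card) * ∏ x ∈ A i, (X - C (t x))
  have hmonic : ∀ i, (∏ x ∈ A i, (X - C (t x))).Monic := fun i => monic_prod_X_sub_C _ _
  have hdeg : ∀ i, (P i).natDegree = a := by
    intro i
    rw [Polynomial.natDegree_mul (pow_ne_zero _ X_ne_zero) (hmonic i).ne_zero, natDegree_X_pow,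
      natDegree_prod_of_monic _ _ fun x _ => monic_X_sub_C _]
    simp [hA i]
  have hlead : ∀ i, (P i).coeff a = 1 := by
    intro i
    have h : (P i).Monic := (monic_X_pow _).mul (hmonic i)
    rw [Monic, leadingCoeff, hdeg] at h
    exact h
  have hroot : ∀ i y, (P i).eval (t y) = 0 ↔ ∃ x ∈ A i, f x = f y := by
    intro i y
    simp only [P, eval_mul, eval_pow, eval_X, eval_prod, eval_sub, eval_C, mul_eq_zero,
      pow_eq_zero_iff', ht0, false_and, false_or, Finset.prod_eq_zero_iff, sub_eq_zero, ht]
    simp only [eq_comm]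
  let c : ι → Fin (a + 1) → ℚ := fun i k => (P i).coeff k
  -- As a function of the coefficients of a polynomial, the product of its values on `B j`. The last
  -- variable, which is 1 on monic polynomials, pads the degree to `b`.
  let φ : ι → MvPolynomial (Fin (a + 1)) ℚ := fun j =>
    (∏ y ∈ B j, ∑ k : Fin (a + 1), MvPolynomial.C (t y ^ (k : ℕ)) * MvPolynomial.X k) *
      MvPolynomial.X (Fin.last a) ^ (b - (B j).card)
  have heval : ∀ i j, MvPolynomial.eval (c i) (φ j) = ∏ y ∈ B j, (P i).eval (t y) := by
    intro i j
    simp only [φ, c, map_mul, map_pow, map_prod, map_sum, MvPolynomial.eval_C, MvPolynomial.eval_X,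
      Fin.val_last, hlead, one_pow, mul_one]
    refine Finset.prod_congr rfl fun y _ => ?_
    rw [eval_eq_sum_range, hdeg, Finset.sum_range]
    exact Finset.sum_congr rfl fun k _ => by simp [mul_comm]
  refine card_le_choose_of_triangular_eval c φ ?_ ?_ ?_
  · intro j
    have h1 : (∏ y ∈ B j, ∑ k : Fin (a + 1), MvPolynomial.C (t y ^ (k : ℕ)) *
        (MvPolynomial.X k : MvPolynomial (Fin (a + 1)) ℚ)).IsHomogeneous (∑ _y ∈ B j, 1) :=
      MvPolynomial.IsHomogeneous.prod _ _ _ fun y _ =>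
        MvPolynomial.IsHomogeneous.sum _ _ _ fun k _ =>
          MvPolynomial.isHomogeneous_C_mul_X _ _
    have h2 := h1.mul (MvPolynomial.isHomogeneous_X_pow (R := ℚ) (Fin.last a) (b - (B j).card))
    have h3 : ∑ _y ∈ B j, 1 + (b - (B j).card) = b := by simp [hB j]
    rwa [h3] at h2
  · intro i
    rw [heval, Finset.prod_ne_zero_iff]
    intro y hy h
    obtain ⟨x, hx, hxy⟩ := (hroot i y).mp h
    exact Finset.disjoint_left.mp (hdisj i) hx (hfinj i i x hx y hy hxy ▸ hy)
  · intro i j hij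
    obtain ⟨y, hyA, hyB⟩ := Finset.not_disjoint_iff.mp (hmeet i j hij)
    rw [heval]
    exact Finset.prod_eq_zero hyB ((hroot i y).mpr ⟨y, hyA, rfl⟩)

theorem Set.encard_le_of_forall_finset {α : Type*} {S : Set α} {n : ℕ}
    (h : ∀ T : Finset α, (T : Set α) ⊆ S → T.card ≤ n) : S.encard ≤ n := by
  by_contra hlt
  obtain ⟨T, hTS, hT⟩ := Set.exists_subset_encard_eq (Order.add_one_le_of_lt (not_le.mp hlt))
  have hfin : T.Finite := Set.finite_of_encard_eq_coe (k := n + 1) (by exact_mod_cast hT)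
  lift T to Finset α using hfin
  rw [Set.encard_coe_eq_coe_finsetCard] at hT
  have := h T hTS
  have : T.card = n + 1 := by exact_mod_cast hT
  omega

/-- A family of sets of size `a`, in which each set is disjoint from some set of size at most `b`
that meets all the other members, has at most `(a + b).choose a` members. -/
theorem encard_le_choose_of_blocking {α : Type*} {S : Set (Finset α)} {a b : ℕ}
    (hcard : ∀ E ∈ S, E.card ≤ a)
    (hblock : ∀ E ∈ S, ∃ B : Finset α, B.card ≤ b ∧ Disjoint E B ∧
      ∀ E' ∈ S, E' ≠ E → ¬ Disjoint E' B) :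
    S.encard ≤ ((a + b).choose a : ℕ) := by
  refine Set.encard_le_of_forall_finset fun T hT => ?_
  choose! B hB hdisj hmeet using hblock
  let e := T.equivFin.symm
  have he : ∀ i, (e i : Finset α) ∈ S := fun i => hT (e i).2
  have h := card_le_choose_of_skew_set_pairs (fun i : Fin T.card => (e i : Finset α))
    (fun i => B (e i)) (fun i => hcard _ (he i)) (fun i => hB _ (he i)) (fun i => hdisj _ (he i))
    (fun i j hij => hmeet _ (he j) _ (he i) fun h => hij.ne (e.injective (Subtype.ext h)))
  simpa using h

/-- A family of `a`-sets with blocking sets as above whose members all contain `T` is smaller. -/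
theorem encard_le_choose_of_blocking_of_subset {α : Type*} {S : Set (Finset α)} {a b : ℕ}
    (T : Finset α) (hcard : ∀ E ∈ S, E.card = a) (hT : ∀ E ∈ S, T ⊆ E)
    (hblock : ∀ E ∈ S, ∃ B : Finset α, B.card ≤ b ∧ Disjoint E B ∧
      ∀ E' ∈ S, E' ≠ E → ¬ Disjoint E' B) :
    S.encard ≤ ((a - T.card + b).choose b : ℕ) := by
  classical
  have hinj : Set.InjOn (fun E => E \ T) S := by
    intro E hE E' hE' h
    rw [← Finset.sdiff_union_of_subset (hT E hE), ← Finset.sdiff_union_of_subset (hT E' hE')]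
    exact congrArg (· ∪ T) h
  rw [← hinj.encard_image, Nat.choose_symm_add.symm]
  apply encard_le_choose_of_blocking
  · rintro _ ⟨E, hE, rfl⟩
    exact (by rw [Finset.card_sdiff_of_subset (hT E hE), hcard E hE] : (E \ T).card = _).le
  · rintro _ ⟨E, hE, rfl⟩
    obtain ⟨B, hB, hd, hm⟩ := hblock E hE
    refine ⟨B, hB, hd.mono_left Finset.sdiff_subset, ?_⟩
    rintro _ ⟨E', hE', rfl⟩ hne hdis
    obtain ⟨z, hzE, hzB⟩ := Finset.not_disjoint_iff.mp (hm E' hE' fun h => hne (by rw [h]))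
    refine Finset.disjoint_left.mp hdis (Finset.mem_sdiff.mpr ⟨hzE, fun hzT => ?_⟩) hzB
    exact Finset.disjoint_left.mp hd (hT E hE hzT) hzB

/-! ### Families with property `P` -/

/-- A minimal transversal of the sets `E' \ E`, where `E'` runs over a finite family: every point of
it is the only point in which some `E'` meets it. -/
theorem exists_minimal_blocking {α : Type*} (T : Finset (Finset α)) (E : Finset α)
    (hT : ∀ E' ∈ T, E' ≠ E → ¬ E' ⊆ E) :
    ∃ B : Finset α, Disjoint E B ∧ (∀ E' ∈ T, E' ≠ E → ¬ Disjoint E' B) ∧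
      ∀ b ∈ B, ∃ E' ∈ T, b ∈ E' ∧ ∀ c ∈ B, c ∈ E' → c = b := by
  classical
  let p : Finset α → Prop := fun B => Disjoint E B ∧ ∀ E' ∈ T, E' ≠ E → ¬ Disjoint E' B
  have hp : p (T.biUnion id \ E) := by
    refine ⟨Finset.disjoint_sdiff, fun E' hE' hne hd => hT E' hE' hne fun x hx => ?_⟩
    by_contra hxE
    exact Finset.disjoint_left.mp hd hx
      (Finset.mem_sdiff.mpr ⟨Finset.mem_biUnion.mpr ⟨E', hE', hx⟩, hxE⟩)
  obtain ⟨B, -, hB⟩ := exists_minimal_le_of_wellFoundedLT p _ hp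
  refine ⟨B, hB.prop.1, hB.prop.2, fun b hb => ?_⟩
  have hnot : ¬ p (B.erase b) := fun h =>
    Finset.notMem_erase b B (hB.le_of_le h (Finset.erase_subset b B) hb)
  have : ∃ E' ∈ T, E' ≠ E ∧ Disjoint E' (B.erase b) := by
    by_contra! hcon
    exact hnot ⟨hB.prop.1.mono_right (Finset.erase_subset b B), hcon⟩
  obtain ⟨E', hE', hne, hd⟩ := this
  have huniq : ∀ c ∈ B, c ∈ E' → c = b := by
    intro c hc hcE
    by_contra hcb
    exact Finset.disjoint_left.mp hd hcE (Finset.mem_erase.mpr ⟨hcb, hc⟩)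
  obtain ⟨c, hcE, hcB⟩ := Finset.not_disjoint_iff.mp (hB.prop.2 E' hE' hne)
  exact ⟨E', hE', huniq c hcB hcE ▸ hcE, huniq⟩

theorem HasPropertyP.not_disjoint {α : Type*} {m : ℕ} {F : Set (Finset α)} (hm : 1 ≤ m)
    (hF : HasPropertyP m F) {E E' : Finset α} (hE : E ∈ F) (hE' : E' ∈ F) :
    ¬ Disjoint E E' := by
  intro hd
  obtain ⟨j, hj⟩ := hF.2 2 (by norm_num) ![E, E'] (by
    intro i
    fin_cases i <;> assumption)
  have hd' : Disjoint (E : Set α) (E' : Set α) := Finset.disjoint_coe.mpr hd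
  have h1 := hF.1 E hE
  have h2 := hF.1 E' hE'
  have h3 : ∀ G : Fin 2 → Finset α, Disjoint (G 0 : Set α) (G 1) → ∀ j : Fin 2,
      ((G j : Set α) \ ⋃ i, ⋃ (_ : i ≠ j), (G i : Set α)) = G j := by
    intro G hG j
    refine Disjoint.sdiff_eq_left ?_
    simp only [Set.disjoint_iUnion_right]
    intro i hi
    fin_cases i <;> fin_cases j
    · exact absurd rfl hi
    · exact hG.symm
    · exact hG
    · exact absurd rfl hi
  rw [h3 ![E, E'] hd' j, Set.ncard_coe_finset] at hj
  have : (![E, E'] j).card = m := by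
    fin_cases j <;> assumption
  omega

/-- With `m + 1` such points, the sets witnessing them would each keep a private point, while `m /
(m + 1) = 0`. -/
theorem HasPropertyP.card_le_of_private {α : Type*} {m : ℕ} {F : Set (Finset α)}
    (hF : HasPropertyP m F) (B : Finset α)
    (hB : ∀ b ∈ B, ∃ E ∈ F, b ∈ E ∧ ∀ c ∈ B, c ∈ E → c = b) : B.card ≤ m := by
  by_contra! hlt
  choose! G hGF hGb hGu using hB
  obtain ⟨B', hB', hcard⟩ := Finset.exists_subset_card_eq (show m + 1 ≤ B.card from hlt)
  let e : Fin (m + 1) ≃ B' := (Fin.castOrderIso hcard.symm).toEquiv.trans B'.equivFin.symm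
  have he : ∀ i, (e i : α) ∈ B := fun i => hB' (e i).2
  obtain ⟨j, hj⟩ := hF.2 (m + 1) (by omega) (fun i => G (e i)) fun i => hGF _ (he i)
  rw [Nat.div_eq_of_lt (Nat.lt_succ_self m), Nat.le_zero,
    Set.ncard_eq_zero ((Finset.finite_toSet _).subset Set.sdiff_subset)] at hj
  have hmem : (e j : α) ∈ ((G (e j) : Set α) \ ⋃ i, ⋃ (_ : i ≠ j), (G (e i) : Set α)) := by
    refine ⟨hGb _ (he j), ?_⟩
    simp only [Set.mem_iUnion, not_exists]
    intro i hij hmem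
    exact hij (e.injective (Subtype.ext (hGu _ (he i) _ (he j) hmem).symm))
  rw [hj] at hmem
  exact hmem

theorem HasPropertyP.encard_le {α : Type*} {m : ℕ} {F : Set (Finset α)} (hF : HasPropertyP m F) :
    F.encard ≤ ((2 * m - 1).choose m : ℕ) := by
  refine Set.encard_le_of_forall_finset fun T hT => ?_
  -- For `m = 0` truncated subtraction makes the bound `choose 0 0 = 1`.
  rcases Nat.eq_zero_or_pos m with rfl | hm
  · refine Finset.card_le_one.mpr fun E hE E' hE' => ?_
    rw [Finset.card_eq_zero.mp (hF.1 E (hT hE)), Finset.card_eq_zero.mp (hF.1 E' (hT hE'))]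
  have hblock : ∀ E ∈ T, ∃ B : Finset α, B.card ≤ m ∧ Disjoint E B ∧
      ∀ E' ∈ T, E' ≠ E → ¬ Disjoint E' B := by
    intro E hE
    obtain ⟨B, hd, hm, hp⟩ := exists_minimal_blocking T E fun E' hE' hne hsub =>
      hne (Finset.eq_of_subset_of_card_le hsub (by rw [hF.1 E (hT hE), hF.1 E' (hT hE')]))
    exact ⟨B, hF.card_le_of_private B fun b hb =>
      let ⟨E', hE', h⟩ := hp b hb
      ⟨E', hT hE', h⟩, hd, hm⟩
  choose! B hB hdisj hmeet using hblock
  let e := T.equivFin.symm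
  have he : ∀ i, (e i : Finset α) ∈ T := fun i => (e i).2
  have hne : ∀ {i j}, i ≠ j → (e i : Finset α) ≠ e j :=
    fun hij h => hij (e.injective (Subtype.ext h))
  -- All pairs `(E, B E)` come first, then all `(B E, E)`; the mixed condition is that members
  -- intersect.
  let A' : Fin T.card ⊕ₗ Fin T.card → Finset α :=
    fun i => Sum.elim (fun i => (e i : Finset α)) (fun i => B (e i)) (ofLex i)
  let B' : Fin T.card ⊕ₗ Fin T.card → Finset α :=
    fun i => Sum.elim (fun i => B (e i)) (fun i => (e i : Finset α)) (ofLex i)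
  have hE : ∀ i, (e i : Finset α).card ≤ m := fun i => (hF.1 _ (hT (he i))).le
  have h := card_le_choose_of_skew_set_pairs (a := m) (b := m) A' B'
    (by rintro (i | i); exacts [hE i, hB _ (he i)])
    (by rintro (i | i); exacts [hB _ (he i), hE i])
    (by rintro (i | i); exacts [hdisj _ (he i), (hdisj _ (he i)).symm])
    (by
      rintro (i | i) (j | j) hij
      · exact hmeet _ (he j) _ (he i) (hne (Sum.Lex.inl_lt_inl_iff.mp hij).ne)
      · exact hF.not_disjoint hm (hT (he i)) (hT (he j))
      · exact absurd hij Sum.Lex.not_inr_lt_inl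
      · exact fun h => hmeet _ (he i) _ (he j) (hne (Sum.Lex.inr_lt_inr_iff.mp hij).ne') h.symm)
  have hc : Fintype.card (Fin T.card ⊕ₗ Fin T.card) = T.card + T.card := by
    rw [Fintype.card_lex, Fintype.card_sum, Fintype.card_fin]
  rw [hc] at h
  obtain ⟨n, rfl⟩ : ∃ n, m = n + 1 := ⟨m - 1, by omega⟩
  have h2 : (n + 1 + (n + 1)).choose (n + 1) = 2 * (2 * (n + 1) - 1).choose (n + 1) := by
    rw [show n + 1 + (n + 1) = 2 * n + 1 + 1 by ring, show 2 * (n + 1) - 1 = 2 * n + 1 by omega,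
      Nat.choose_succ_succ, Nat.choose_symm_half]
    ring
  omega

/-! ### Pareto optimal matchings and reachable sets -/

theorem IsPOM.not_pref_of_notMem_range {A B : Type*} {pref : A → B → B → Prop} {τ : A ↪ B}
    (hτ : IsPOM pref τ) (a : A) {b : B} (hb : b ∉ Set.range τ) : ¬ pref a b (τ a) := by
  classical
  intro h
  refine hτ ⟨{a}, ⟨a, rfl⟩, ⟨Function.update τ a b, ?_⟩, fun a' ha' => ?_, fun a' ha' => ?_⟩
  · intro x y hxy
    by_cases hx : x = a <;> by_cases hy : y = a
    · rw [hx, hy]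
    · subst hx
      rw [Function.update_self, Function.update_of_ne hy] at hxy
      exact absurd ⟨y, hxy.symm⟩ hb
    · subst hy
      rw [Function.update_self, Function.update_of_ne hx] at hxy
      exact absurd ⟨x, hxy⟩ hb
    · rw [Function.update_of_ne hx, Function.update_of_ne hy] at hxy
      exact τ.injective hxy
  · exact Function.update_of_ne ha' _ _
  · rw [Set.mem_singleton_iff] at ha'
    subst ha'
    change pref a' (Function.update τ a' b a') (τ a')
    rwa [Function.update_self]

theorem card_soldHouses {A B : Type*} [Fintype A] (τ : A ↪ B) :
    (soldHouses τ).card = Fintype.card A := by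
  simp [soldHouses]

theorem mem_soldHouses {A B : Type*} [Fintype A] {τ : A ↪ B} {b : B} :
    b ∈ soldHouses τ ↔ b ∈ Set.range τ := by
  simp [soldHouses]

theorem card_of_mem_reachableSets {A B : Type*} [Fintype A] {pref : A → B → B → Prop}
    {E : Finset B} (hE : E ∈ reachableSets pref) : E.card = Fintype.card A := by
  obtain ⟨τ, -, rfl⟩ := hE
  exact card_soldHouses τ

/-- Every buyer has a favourite house outside a given finite set of houses. -/
theorem exists_favourite {A B : Type*} [Infinite B] (pref : A → B → B → Prop)
    (hpref : ∀ a, IsWellOrder B (pref a)) (X : Finset B) (a : A) :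
    ∃ b, b ∉ X ∧ ∀ c, c ∉ X → ¬ pref a c b := by
  obtain ⟨b, hb, hmin⟩ := (hpref a).wf.has_min {b | b ∉ X} X.exists_notMem
  exact ⟨b, hb, hmin⟩

/-- The favourite unsold houses of the buyers block all the other reachable sets. -/
theorem exists_blocking_of_mem_reachableSets {A B : Type*} [Fintype A] [Infinite B]
    {pref : A → B → B → Prop} (hpref : ∀ a, IsWellOrder B (pref a)) (E : Finset B) :
    ∃ D : Finset B, D.card ≤ Fintype.card A ∧ Disjoint E D ∧
      ∀ E' ∈ reachableSets pref, E.card = Fintype.card A → E' ≠ E → ¬ Disjoint E' D := by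
  classical
  choose b hbE hb using fun a => exists_favourite pref hpref E a
  refine ⟨Finset.univ.image b, Finset.card_image_le, ?_, ?_⟩
  · rw [Finset.disjoint_right]
    simpa using hbE
  · rintro _ ⟨τ, hτ, rfl⟩ hcard hne hd
    refine hne (Finset.eq_of_subset_of_card_le (fun x hx => ?_) (by rw [hcard, card_soldHouses]))
    obtain ⟨a, rfl⟩ := mem_soldHouses.mp hx
    have hba : b a ∉ soldHouses τ := fun h =>
      Finset.disjoint_left.mp hd h (Finset.mem_image_of_mem b (Finset.mem_univ a))
    by_contra hτE
    have := hpref a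
    rcases trichotomous_of (pref a) (τ a) (b a) with h | h | h
    · exact hb a _ hτE h
    · exact hba (h ▸ hx)
    · exact hτ.not_pref_of_notMem_range a (fun h' => hba (mem_soldHouses.mpr h')) h

theorem encard_reachableSets_of_subset_le {A B : Type*} [Fintype A] [Infinite B]
    {pref : A → B → B → Prop} (hpref : ∀ a, IsWellOrder B (pref a)) (T : Finset B) :
    {E ∈ reachableSets pref | T ⊆ E}.encard ≤
      ((Fintype.card A - T.card + Fintype.card A).choose (Fintype.card A) : ℕ) := by
  refine encard_le_choose_of_blocking_of_subset T (fun E hE => card_of_mem_reachableSets hE.1)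
    (fun E hE => hE.2) fun E hE => ?_
  obtain ⟨D, hD, hd, hm⟩ := exists_blocking_of_mem_reachableSets hpref E
  exact ⟨D, hD, hd, fun E' hE' => hm E' hE'.1 (card_of_mem_reachableSets hE.1)⟩

/-- In a Pareto optimal matching, a buyer who gets no house of `X` forces her favourite house
outside `X` to be sold. -/
theorem IsPOM.favourite_mem {A B : Type*} {pref : A → B → B → Prop}
    (hpref : ∀ a, IsWellOrder B (pref a)) {τ : A ↪ B} (hτ : IsPOM pref τ) {X : Finset B} {a : A}
    {b : B} (hb : ∀ c, c ∉ X → ¬ pref a c b) (ha : τ a ∉ X) : b ∈ Set.range τ := by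
  by_contra hbτ
  have := hpref a
  rcases trichotomous_of (pref a) (τ a) b with h | h | h
  · exact hb _ ha h
  · exact hbτ ⟨a, h⟩
  · exact hτ.not_pref_of_notMem_range a hbτ h

/-- At most `#X` buyers have an unsold favourite house outside `X`. -/
theorem IsPOM.card_le_of_favourite_notMem {A B : Type*} {pref : A → B → B → Prop}
    (hpref : ∀ a, IsWellOrder B (pref a)) {τ : A ↪ B} (hτ : IsPOM pref τ) {X : Finset B}
    {b : A → B} (hb : ∀ a c, c ∉ X → ¬ pref a c (b a)) (S : Finset A)
    (hS : ∀ a ∈ S, b a ∉ Set.range τ) : S.card ≤ X.card := by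
  refine Finset.card_le_card_of_injOn τ (fun a ha => ?_) τ.injective.injOn
  by_contra hX
  exact hS a ha (hτ.favourite_mem hpref (hb a) hX)

/-! ### Counting reachable sets -/

/-- Raising the top from `n` to `n + 1` multiplies by `(n + 1) / (n + 1 - m)`, at least 2 while `n +
1 ≤ 2m`. -/
theorem two_pow_mul_choose_le {m : ℕ} (r n : ℕ) (h : n + r ≤ 2 * m) :
    2 ^ r * n.choose m ≤ (n + r).choose m := by
  induction r with
  | zero => simp
  | succ r ih =>
    have h1 := ih (by omega)
    have h2 : 2 * (n + r).choose m ≤ (n + r + 1).choose m := by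
      rcases lt_or_ge (n + r) m with hlt | hge
      · simp [Nat.choose_eq_zero_of_lt hlt]
      · have h3 := Nat.choose_mul_succ_eq (n + r) m
        have h4 : 2 * (n + r + 1 - m) ≤ n + r + 1 := by omega
        have h5 : 0 < n + r + 1 - m := by omega
        nlinarith [Nat.mul_le_mul_left ((n + r).choose m) h4]
    calc 2 ^ (r + 1) * n.choose m = 2 * (2 ^ r * n.choose m) := by ring
      _ ≤ 2 * (n + r).choose m := Nat.mul_le_mul_left 2 h1
      _ ≤ _ := h2

theorem sq_le_two_pow {n : ℕ} (hn : 6 ≤ n) : (n + 1) ^ 2 ≤ 2 ^ n := by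
  induction n, hn using Nat.le_induction with
  | base => norm_num
  | succ n hn ih => rw [pow_succ 2]; nlinarith

/-- Families with many common points are few, even if the common points depend on the member. -/
theorem encard_reachableSets_of_large_inter_le {A B : Type*} [Fintype A] [Infinite B]
    [DecidableEq B] {pref : A → B → B → Prop} (hpref : ∀ a, IsWellOrder B (pref a))
    (D : Finset B) (t : ℕ) (h : ∀ E ∈ reachableSets pref, t ≤ (E ∩ D).card) :
    (reachableSets pref).encard ≤
      (D.card.choose t * (Fintype.card A - t + Fintype.card A).choose (Fintype.card A) : ℕ) := by
  have hcover : reachableSets pref ⊆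
      ⋃ T ∈ D.powersetCard t, {E ∈ reachableSets pref | T ⊆ E} := by
    intro E hE
    obtain ⟨T, hT, hc⟩ := Finset.exists_subset_card_eq (h E hE)
    simp only [Set.mem_iUnion]
    exact ⟨T, Finset.mem_powersetCard.mpr ⟨hT.trans Finset.inter_subset_right, hc⟩, hE,
      hT.trans Finset.inter_subset_left⟩
  refine (Set.encard_le_encard hcover).trans ?_
  refine (Finset.set_encard_biUnion_le _ _).trans ?_
  refine (Finset.sum_le_card_nsmul _ _
    ((Fintype.card A - t + Fintype.card A).choose (Fintype.card A) : ℕ∞) fun T hT => ?_).trans ?_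
  · have := encard_reachableSets_of_subset_le hpref T
    rwa [(Finset.mem_powersetCard.mp hT).2] at this
  · rw [Finset.card_powersetCard, nsmul_eq_mul]
    push_cast
    exact le_rfl

theorem encard_reachableSets_le {A B : Type*} [Fintype A] [Infinite B]
    {pref : A → B → B → Prop} (hpref : ∀ a, IsWellOrder B (pref a)) {s : ℕ} (hs : 7 ≤ s)
    (hsA : s ^ 3 ≤ Fintype.card A) :
    (reachableSets pref).encard ≤
      ((2 * Fintype.card A - s).choose (Fintype.card A) : ℕ) := by
  classical
  set m := Fintype.card A with hm
  have hsm : s ^ 2 ≤ m := (Nat.pow_le_pow_right (by omega) (by norm_num)).trans hsA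
  have hss : s ≤ s ^ 2 := Nat.le_self_pow (by norm_num) s
  rcases (reachableSets pref).eq_empty_or_nonempty with hemp | ⟨E₀, hE₀⟩
  · simp [hemp]
  let X : Finset B := E₀.filter fun x => ∀ E ∈ reachableSets pref, x ∈ E
  have hX : ∀ x, x ∈ X ↔ ∀ E ∈ reachableSets pref, x ∈ E := fun x => by
    simp only [X, Finset.mem_filter]
    exact ⟨fun h => h.2, fun h => ⟨h E₀ hE₀, h⟩⟩
  rcases le_or_gt s X.card with hsX | hXs
  · obtain ⟨T, hTX, hT⟩ := Finset.exists_subset_card_eq hsX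
    have h := encard_reachableSets_of_subset_le hpref T
    rw [hT, ← hm, show m - s + m = 2 * m - s by omega] at h
    refine (Set.encard_le_encard fun E hE => ?_).trans h
    exact ⟨hE, fun x hx => (hX x).mp (hTX hx) E hE⟩
  · choose b hbX hb using fun a => exists_favourite pref hpref X a
    -- Some reachable set misses `y`; in its matching all buyers with favourite `y` must receive
    -- houses of `X`.
    have hfib : ∀ y ∈ Finset.univ.image b, (Finset.univ.filter fun a => b a = y).card ≤ s := by
      intro y hy
      obtain ⟨a, -, rfl⟩ := Finset.mem_image.mp hy
      have hnot := mt (hX (b a)).mpr (hbX a)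
      push Not at hnot
      obtain ⟨_, ⟨τ, hτ, rfl⟩, hbτ⟩ := hnot
      refine (hτ.card_le_of_favourite_notMem hpref hb _ fun a' ha' => ?_).trans hXs.le
      rw [(Finset.mem_filter.mp ha').2]
      exact fun h => hbτ (mem_soldHouses.mpr h)
    have hD : s ^ 2 ≤ (Finset.univ.image b).card := by
      have h := Finset.card_le_mul_card_image (Finset.univ : Finset A) s hfib
      rw [Finset.card_univ, ← hm] at h
      refine Nat.le_of_mul_le_mul_left (?_ : s * s ^ 2 ≤ s * _) (by omega)
      calc s * s ^ 2 = s ^ 3 := by ring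
        _ ≤ _ := hsA.trans h
    obtain ⟨D, hDsub, hDcard⟩ := Finset.exists_subset_card_eq hD
    -- One buyer per missed house of `D`: these buyers all receive houses of `X`, so at most `s - 1`
    -- houses are missed.
    have hinter : ∀ E ∈ reachableSets pref, s ^ 2 - (s - 1) ≤ (E ∩ D).card := by
      rintro _ ⟨τ, hτ, rfl⟩
      have : Nonempty A := Fintype.card_pos_iff.mp ((by positivity : 0 < s ^ 3).trans_le hsA)
      choose! g hg using fun y (hy : y ∈ D) =>
        let ⟨a, _, ha⟩ := Finset.mem_image.mp (hDsub hy)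
        (⟨a, ha⟩ : ∃ a, b a = y)
      have h1 : (D \ soldHouses τ).card ≤ X.card := by
        rw [← Finset.card_image_of_injOn (f := g)]
        · refine hτ.card_le_of_favourite_notMem hpref hb _ fun a ha => ?_
          obtain ⟨y, hy, rfl⟩ := Finset.mem_image.mp ha
          rw [Finset.mem_sdiff, mem_soldHouses] at hy
          rw [hg y hy.1]
          exact hy.2
        · intro y hy z hz hyz
          rw [← hg y (Finset.mem_sdiff.mp hy).1, ← hg z (Finset.mem_sdiff.mp hz).1, hyz]
      have h2 := Finset.card_sdiff_add_card_inter D (soldHouses τ)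
      rw [Finset.inter_comm]
      omega
    refine (encard_reachableSets_of_large_inter_le hpref D _ hinter).trans ?_
    rw [← hm, hDcard, Nat.cast_le]
    obtain ⟨r, rfl⟩ : ∃ r, s = r + 1 := ⟨s - 1, by omega⟩
    have hsq : (r + 1) ^ 2 = r ^ 2 + 2 * r + 1 := by ring
    -- The choice of common houses costs at most `2 ^ r ^ 2`, which is paid for by raising the top
    -- by `r ^ 2`.
    calc ((r + 1) ^ 2).choose ((r + 1) ^ 2 - (r + 1 - 1)) *
          (m - ((r + 1) ^ 2 - (r + 1 - 1)) + m).choose m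
        = ((r + 1) ^ 2).choose r * (2 * m - (r + 1) - r ^ 2).choose m := by
          rw [show r + 1 - 1 = r by omega, Nat.choose_symm (by omega),
            show m - ((r + 1) ^ 2 - r) + m = 2 * m - (r + 1) - r ^ 2 by omega]
      _ ≤ 2 ^ r ^ 2 * (2 * m - (r + 1) - r ^ 2).choose m := by
          refine Nat.mul_le_mul_right _ ((Nat.choose_le_pow _ _).trans ?_)
          rw [sq r, pow_mul]
          exact Nat.pow_le_pow_left (sq_le_two_pow (by omega)) r
      _ ≤ (2 * m - (r + 1) - r ^ 2 + r ^ 2).choose m := two_pow_mul_choose_le _ _ (by omega)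
      _ = (2 * m - (r + 1)).choose m := by
          rw [show 2 * m - (r + 1) - r ^ 2 + r ^ 2 = 2 * m - (r + 1) by omega]

theorem theorem1 :
    (∃ M : ℕ, ∀ m : ℕ, M ≤ m → ∀ l : ℕ, IsGreatest {n : ℕ | n ^ n ≤ m} l →
      maxReachable.{u} m ≤ ((2 * m - l + 4).choose m : ℕ∞)) ∧
    (∀ m : ℕ,
      (∀ (α : Type u) (F : Set (Finset α)), HasPropertyP m F →
        F.encard ≤ ((2 * m - 1).choose m : ℕ∞)) ∧
      maxPropertyP.{u} m ≤ ((2 * m - 1).choose m : ℕ∞)) := by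
  refine ⟨⟨11 ^ 11, fun m hm l hl => ?_⟩, fun m => ⟨fun α F hF => hF.encard_le, ?_⟩⟩
  -- `s = l - 4` needs `s ≥ 7`, hence `l ≥ 11`. Of `l ^ l ≤ m` little more than `(l - 4) ^ 3 ≤ m` is
  -- used.
  · have hl11 : 11 ≤ l := hl.2 hm
    have hlm : l ^ l ≤ m := hl.1
    have hs : (l - 4) ^ 3 ≤ m :=
      ((Nat.pow_le_pow_left (by omega) 3).trans (Nat.pow_le_pow_right (by omega) (by omega))).trans
        hlm
    have hllm : l ≤ m := (Nat.le_self_pow (by omega) l).trans hlm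
    refine iSup_le fun B => iSup_le fun _ => iSup_le fun pref => iSup_le fun hpref => ?_
    have h := encard_reachableSets_le hpref (s := l - 4) (by omega) (by simpa using hs)
    rwa [Fintype.card_fin, show 2 * m - (l - 4) = 2 * m - l + 4 by omega] at h
  · exact iSup_le fun α => iSup_le fun F => iSup_le fun hF => hF.encard_le
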